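/- Let $k$ be an algebraically closed field and let $X=X_1\cup X_2\cup X_3$ be a reduced proper curve over $k$ whose components $X_q$ are smooth and irreducible, where $X_1$ and $X_2$ meet transversally at exactly one point $A$, $X_2$ and $X_3$ meet transversally at exactly one point $B\neq A$, and $X_1\cap X_3=\emptyset$. For a union $Y$ of components let $Y^c$ be the union of the other components. Put $e_1=(-1,1,0)$, $e_2=(1,-2,1)$, $e_3=(0,1,-1)$; $e_q$ is the multidegree of the invertible sheaf $\mathcal O_{(X_q)}$ on $X$ whose restriction to $X_q$ is $\mathcal O_{X_q}(-X_q\cap X_q^c)$ and whose restriction to $X_q^c$ is $\mathcal O_{X_q^c}(X_q\cap X_q^c)$. Let $d,r\ge 0$ be integers. In what follows multidegrees $\underline d$ are triples of nonnegative integers with sum $d$. Let $\mathcal L_{\underline d}$ be invertible sheaves on $X$ of multidegree $\underline d$, one for each $\underline d$, linked, for every $q$ and all $\underline d$, $\underline d'=\underline d+e_q$, by morphisms $\varphi_{\underline d,\underline d'}$ and $\varphi_{\underline d',\underline d}$ (so that $\mathcal L_{\underline d'}\cong\mathcal L_{\underline d}\otimes\mathcal O_{(X_q)}$) such that (1) $\varphi_{\underline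 d,\underline d'}$ factors as $\mathcal L_{\underline d}\to\mathcal L_{\underline d}|_{X_q^c}\cong\mathcal L_{\underline d'}|_{X_q^c}(-X_q\cap X_q^c)\hookrightarrow\mathcal L_{\underline d'}$ (restriction, isomorphism, inclusion); (2) $\varphi_{\underline d',\underline d}$ factors as $\mathcal L_{\underline d'}\to\mathcal L_{\underline d'}|_{X_q}\cong\mathcal L_{\underline d}|_{X_q}(-X_q\cap X_q^c)\hookrightarrow\mathcal L_{\underline d}$; (3) $\varphi_{\underline d^2,\underline d^3}\circ\varphi_{\underline d^1,\underline d^2}=\varphi_{\underline d^1,\underline d^3}$ whenever $\underline d^2=\underline d^1+e_{q_1}$, $\underline d^3=\underline d^2+e_{q_2}$ and $q_1\ne q_2$. For arbitrary multidegrees $\underline d^0,\underline d$, let $\varphi_{\underline d^0,\underline d}$ be the composition of these maps along any path of multidegrees from $\underline d^0$ to $\underline d$, each step adding or subtracting some $e_q$, such that not all of $e_1,e_2,e_3$ are added, no $e_q$ is both added and subtracted, and at most one of $e_1,e_2,e_3$ is subtracted; such a path exists and the composition does not depend on it. In particular $\varphi_{\underline d,\underline d}=\mathrm{id}$. A limit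 linear series of degree $d$ and dimension $r$ is given by such data and subspaces $V_{\underline d}\subseteq H^0(X,\mathcal L_{\underline d})$ of dimension $r+1$, one for each $\underline d$, that are mapped into each other by the linking maps between $\underline d$ and $\underline d+e_q$. Let $V_{\underline d}^{X_q,0}\subseteq V_{\underline d}$ be the subspace of sections vanishing on $X_q$. A simple basis consists of distinct multidegrees $\underline d^1,\dots,\underline d^m$ and, for each $\alpha$, linearly independent sections $s^\alpha_1,\dots,s^\alpha_{r_\alpha}\in V_{\underline d^\alpha}$ with $r_\alpha\ge 1$, such that for every $\underline d$ the sections $\varphi_{\underline d^\alpha,\underline d}(s^\alpha_j)$, $1\le\alpha\le m$, $1\le j\le r_\alpha$, form a basis of $V_{\underline d}$. The limit linear series is simple if it has a simple basis. **Proposition.** For a simple limit linear series of degree $d$ and dimension $r$ the following hold. 1. $\displaystyle\sum_{\underline d}\dim\left(\frac{V_{\underline d}}{V_{\underline d}^{X_1,0}+V_{\underline d}^{X_2,0}+V_{\underline d}^{X_3,0}}\right)=r+1.$ 2. For every simple basis as above and every $\underline d$, $$V_{\underline d}^{X_1,0}+V_{\underline d}^{X_2,0}+V_{\underline d}^{X_3,0}\neq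 V_{\underline d}\quad\text{if and only if}\quad \underline d=\underline d^\alpha\text{ for some }\alpha,$$ and for every $\alpha$ $$V_{\underline d^\alpha}=\left(V_{\underline d^\alpha}^{X_1,0}+V_{\underline d^\alpha}^{X_2,0}+V_{\underline d^\alpha}^{X_3,0}\right)\oplus\left\langle s^\alpha_1,\dots,s^\alpha_{r_\alpha}\right\rangle.$$ -/

import Mathlib

open CategoryTheory AlgebraicGeometry

universe u

noncomputable section

namespace LimitLinear

/-! ### Invertible sheaves, vanishing and degree -/

/-- `e` is a local generator (frame) of the sheaf of modules `M` over `U`: for every open `W ≤ U`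
the map `f ↦ f • e|_W` is a bijection from `Γ(X, W)` to `Γ(M, W)`. Equivalently, `e` is an
isomorphism `𝒪_U ≅ M|_U`. -/
def IsFrame {X : Scheme.{u}} {M : X.Modules} {U : X.Opens} (e : Γ(M, U)) : Prop :=
  ∀ (W : X.Opens) (h : W ≤ U),
    Function.Bijective (fun f : Γ(X, W) => f • M.presheaf.map (homOfLE h).op e)

/-- `M` is an invertible sheaf: locally free of rank one. -/
def IsInvertibleSheaf {X : Scheme.{u}} (M : X.Modules) : Prop :=
  ∀ x : X, ∃ (U : X.Opens) (_ : x ∈ U) (e : Γ(M, U)), IsFrame e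

/-- The section `s` of `M` over `U` lies in `I · M`, where `I` assigns to every open set an ideal of
regular functions: locally on `U`, it is a sum of products `f • t` with `f ∈ I`. -/
def LiesIn {X : Scheme.{u}} (I : ∀ W : X.Opens, Ideal Γ(X, W)) {M : X.Modules} {U : X.Opens}
    (s : Γ(M, U)) : Prop :=
  ∀ x ∈ U, ∃ (W : X.Opens) (_ : x ∈ W) (h : W ≤ U),
    M.presheaf.map (homOfLE h).op s ∈ I W • (⊤ : Submodule Γ(X, W) Γ(M, W))

lemma map_map {X : Scheme.{u}} {M : X.Modules} {U V W : X.Opens} (h : V ≤ U) (h' : W ≤ V)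
    (s : Γ(M, U)) :
    M.presheaf.map (homOfLE h').op (M.presheaf.map (homOfLE h).op s) =
      M.presheaf.map (homOfLE (h'.trans h)).op s := by
  rw [← ConcreteCategory.comp_apply, ← M.presheaf.map_comp]
  rfl

/-- The restriction to a smaller open set of an element of `I · M` is in `I · M`. -/
lemma map_mem_smul_top {X : Scheme.{u}} {I : ∀ W : X.Opens, Ideal Γ(X, W)}
    (hI : ∀ (V W : X.Opens) (h : W ≤ V) (f : Γ(X, V)), f ∈ I V →
      X.presheaf.map (homOfLE h).op f ∈ I W)
    {M : X.Modules} {V W : X.Opens} (h : W ≤ V) {s : Γ(M, V)}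
    (hs : s ∈ I V • (⊤ : Submodule Γ(X, V) Γ(M, V))) :
    M.presheaf.map (homOfLE h).op s ∈ I W • (⊤ : Submodule Γ(X, W) Γ(M, W)) := by
  induction hs using Submodule.smul_induction_on' with
  | smul r hr t ht =>
    rw [Scheme.Modules.map_smul]
    exact Submodule.smul_mem_smul (hI V W h r hr) trivial
  | add x _ y _ hx hy =>
    rw [map_add]
    exact add_mem hx hy

lemma LiesIn.zero {X : Scheme.{u}} {I : ∀ W : X.Opens, Ideal Γ(X, W)} {M : X.Modules}
    {U : X.Opens} : LiesIn I (0 : Γ(M, U)) :=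
  fun _ hx => ⟨U, hx, le_rfl, by rw [map_zero]; exact zero_mem _⟩

lemma LiesIn.add {X : Scheme.{u}} {I : ∀ W : X.Opens, Ideal Γ(X, W)}
    (hI : ∀ (V W : X.Opens) (h : W ≤ V) (f : Γ(X, V)), f ∈ I V →
      X.presheaf.map (homOfLE h).op f ∈ I W)
    {M : X.Modules} {U : X.Opens} {s t : Γ(M, U)} (hs : LiesIn I s) (ht : LiesIn I t) :
    LiesIn I (s + t) := by
  intro x hx
  obtain ⟨W₁, hx₁, h₁, hs⟩ := hs x hx
  obtain ⟨W₂, hx₂, h₂, ht⟩ := ht x hx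
  refine ⟨W₁ ⊓ W₂, ⟨hx₁, hx₂⟩, inf_le_left.trans h₁, ?_⟩
  have hs' := map_mem_smul_top hI (inf_le_left : W₁ ⊓ W₂ ≤ W₁) hs
  have ht' := map_mem_smul_top hI (inf_le_right : W₁ ⊓ W₂ ≤ W₂) ht
  rw [map_map] at hs' ht'
  rw [map_add]
  exact add_mem hs' ht'

lemma LiesIn.smul {X : Scheme.{u}} {I : ∀ W : X.Opens, Ideal Γ(X, W)} {M : X.Modules}
    {U : X.Opens} (a : Γ(X, U)) {s : Γ(M, U)} (hs : LiesIn I s) : LiesIn I (a • s) := by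
  intro x hx
  obtain ⟨W, hx, h, hs⟩ := hs x hx
  refine ⟨W, hx, h, ?_⟩
  rw [Scheme.Modules.map_smul]
  exact Submodule.smul_mem _ _ hs

/-- The functions on `W` whose pullback along `f : Y ⟶ X` is zero; for a closed subscheme `Y` these
are the sections over `W` of its ideal sheaf. -/
def idealOf {X Y : Scheme.{u}} (f : Y ⟶ X) (W : X.Opens) : Ideal Γ(X, W) :=
  RingHom.ker (f.app W).hom

/-- For `f : C ⟶ X` with `C` an integral curve and `M` invertible on `X`, the pullback to `C` of the
section `s` of `M` over `U`, viewed as a nonzero rational section of `f^* M`, has order `n` at the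
point `x` of `C`: near `f x` one has `s = g • e` with `e` a local generator of `M`, and the rational
function on `C` given by the pullback of `g` is nonzero and has order `n` at `x`. -/
def HasOrderAt {X C : Scheme.{u}} [IsIntegral C] [IsLocallyNoetherian C] (f : C ⟶ X)
    {M : X.Modules} {U : X.Opens} (s : Γ(M, U)) (x : C) (n : ℤ) : Prop :=
  ∃ (W : X.Opens) (_ : f x ∈ W) (e : Γ(M, W)) (g : Γ(X, U ⊓ W))
    (_ : Nonempty (f ⁻¹ᵁ (U ⊓ W))),
    IsFrame e ∧
    M.presheaf.map (homOfLE (inf_le_left : U ⊓ W ≤ U)).op s =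
      g • M.presheaf.map (homOfLE (inf_le_right : U ⊓ W ≤ W)).op e ∧
    C.germToFunctionField (f ⁻¹ᵁ (U ⊓ W)) ((f.app (U ⊓ W)).hom g) ≠ 0 ∧
    Scheme.ord (C.germToFunctionField (f ⁻¹ᵁ (U ⊓ W)) ((f.app (U ⊓ W)).hom g)) x = n

/-- For `f : C ⟶ X` with `C` a proper integral curve over an algebraically closed field and `M`
invertible on `X`, the degree of `f^* M` is `n`: the divisor of zeros and poles of the nonzero
rational section of `f^* M` given by any local section of `M` whose pullback to `C` is not zero has
degree `n`. (The closed points of `C` have residue degree one, and orders are zero at the generic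
point by convention.) -/
def HasDegreeAlong {X C : Scheme.{u}} [IsIntegral C] [IsLocallyNoetherian C] (f : C ⟶ X)
    (M : X.Modules) (n : ℤ) : Prop :=
  ∀ (U : X.Opens) (s : Γ(M, U)), ¬ LiesIn (idealOf f) s →
    ∃ D : C → ℤ, (∀ x, HasOrderAt f s x (D x)) ∧ (Function.support D).Finite ∧ ∑ᶠ x, D x = n

/-! ### The curve -/

/-- A curve `X = X₁ ∪ X₂ ∪ X₃` of compact type over `k`: a reduced proper `k`-scheme which is the
union of three closed subschemes, each a smooth irreducible curve (indexed by `0, 1, 2`), such that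
`X₁` and `X₂` meet transversally at one point `A`, `X₂` and `X₃` meet transversally at one point
`B`, and `X₁` and `X₃` are disjoint (so `A ≠ B`). -/
structure ChainCurve (k : Type u) [Field k] where
  X : Scheme.{u}
  str : X ⟶ Spec (.of k)
  comp : Fin 3 → Scheme.{u}
  ι : ∀ q, comp q ⟶ X
  isReduced : IsReduced X
  isProper : IsProper str
  isClosedImmersion : ∀ q, IsClosedImmersion (ι q)
  isIntegral : ∀ q, IsIntegral (comp q)
  smooth : ∀ q, Smooth (ι q ≫ str)
  dim_eq_one : ∀ q, topologicalKrullDim (comp q) = 1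
  exists_mem_range : ∀ x : X, ∃ q, x ∈ Set.range (ι q)
  /-- The scheme-theoretic intersection of `X₁` and `X₂` is one reduced `k`-rational point `A`. -/
  nodeA : IsIso (Limits.pullback.fst (ι 0) (ι 1) ≫ ι 0 ≫ str)
  /-- The scheme-theoretic intersection of `X₂` and `X₃` is one reduced `k`-rational point `B`. -/
  nodeB : IsIso (Limits.pullback.fst (ι 1) (ι 2) ≫ ι 1 ≫ str)
  disjoint : Disjoint (Set.range (ι 0)) (Set.range (ι 2))

namespace ChainCurve

variable {k : Type u} [Field k] (C : ChainCurve k)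

instance (q : Fin 3) : IsIntegral (C.comp q) := C.isIntegral q

instance (q : Fin 3) : IsLocallyNoetherian (C.comp q) :=
  haveI := C.smooth q
  LocallyOfFiniteType.isLocallyNoetherian (C.ι q ≫ C.str)

/-- The ring homomorphism `k → Γ(X, 𝒪_X)` of the structure morphism. -/
def scalars : k →+* Γ(C.X, ⊤) :=
  (C.str.appTop.hom).comp (Scheme.ΓSpecIso (.of k)).inv.hom

/-- The space `H⁰(X, M)` of global sections, a vector space over `k`. -/
def H0 (M : C.X.Modules) : Type u := Γ(M, (⊤ : C.X.Opens))

instance (M : C.X.Modules) : AddCommGroup (C.H0 M) :=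
  inferInstanceAs (AddCommGroup Γ(M, (⊤ : C.X.Opens)))

instance (M : C.X.Modules) : Module Γ(C.X, ⊤) (C.H0 M) :=
  inferInstanceAs (Module Γ(C.X, ⊤) Γ(M, (⊤ : C.X.Opens)))

instance (M : C.X.Modules) : Module k (C.H0 M) :=
  Module.compHom _ C.scalars

/-- The `k`-linear map on global sections induced by a morphism of sheaves of modules. -/
def H0map {M N : C.X.Modules} (φ : M ⟶ N) : C.H0 M →ₗ[k] C.H0 N where
  toFun s := φ.app ⊤ s
  map_add' s t := map_add (φ.app ⊤).hom s t
  map_smul' a s := Scheme.Modules.Hom.app_smul φ (C.scalars a) s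

/-- The ideal sheaf of the subcurve `Y` that is the union of the components with index in `S`. -/
def ideal (S : Set (Fin 3)) (W : C.X.Opens) : Ideal Γ(C.X, W) :=
  ⨅ q ∈ S, idealOf (C.ι q) W

/-- The section `s` of `M` vanishes on the union `Y` of the components with index in `S`: it is a
section of `I_Y · M`, the kernel of the restriction `M → M|_Y`. -/
def VanishesOn (S : Set (Fin 3)) {M : C.X.Modules} {U : C.X.Opens} (s : Γ(M, U)) : Prop :=
  LiesIn (C.ideal S) s

lemma ideal_map (S : Set (Fin 3)) (V W : C.X.Opens) (h : W ≤ V) (f : Γ(C.X, V))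
    (hf : f ∈ C.ideal S V) : C.X.presheaf.map (homOfLE h).op f ∈ C.ideal S W := by
  simp only [ideal, idealOf, Submodule.mem_iInf, RingHom.mem_ker] at hf ⊢
  intro q hq
  have h1 := congr($((C.ι q).naturality (homOfLE h).op) f)
  rw [CommRingCat.comp_apply, CommRingCat.comp_apply] at h1
  refine h1.trans ?_
  erw [hf q hq]
  exact map_zero _

/-- The subspace of `H⁰(X, M)` of the sections vanishing on the union of the components with index
in `S`. -/
def vanishing (S : Set (Fin 3)) (M : C.X.Modules) : Submodule k (C.H0 M) where
  carrier := {s | C.VanishesOn S (M := M) (U := ⊤) s}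
  zero_mem' := LiesIn.zero
  add_mem' hs ht := LiesIn.add (C.ideal_map S) hs ht
  smul_mem' a _ hs := LiesIn.smul (C.scalars a) hs

/-- With `Y` the union of the components with index in `S` and `Yᶜ` the union of the others,
`φ : M ⟶ N` is the composition of the restriction `M → M|_Y`, an isomorphism
`M|_Y ≅ N|_Y(-Y ∩ Yᶜ)` and the inclusion of `N|_Y(-Y ∩ Yᶜ)` in `N`, where `N|_Y(-Y ∩ Yᶜ)` is the
kernel of `N → N|_{Yᶜ}`. That is: the kernel of `φ` is the subsheaf of the sections of `M` vanishing
on `Y`, and the image sheaf of `φ` is the subsheaf of the sections of `N` vanishing on `Yᶜ`. -/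
def FactorsThroughRestriction (S : Set (Fin 3)) {M N : C.X.Modules} (φ : M ⟶ N) : Prop :=
  (∀ (U : C.X.Opens) (s : Γ(M, U)), φ.app U s = 0 ↔ C.VanishesOn S s) ∧
  (∀ (U : C.X.Opens) (t : Γ(N, U)), C.VanishesOn Sᶜ t ↔
    ∀ x ∈ U, ∃ (W : C.X.Opens) (_ : x ∈ W) (h : W ≤ U) (s : Γ(M, W)),
      φ.app W s = N.presheaf.map (homOfLE h).op t)

end ChainCurve

/-! ### Multidegrees and paths -/

/-- The nonnegative multidegrees `(i, d - i - l, l)` of total degree `d`. -/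
abbrev Multidegree (d : ℕ) : Type := {v : Fin 3 → ℕ // ∑ q, v q = d}

instance (d : ℕ) : Fintype (Multidegree d) :=
  Fintype.subtype (Finset.Nat.antidiagonalTuple 3 d)
    (fun _ => Finset.Nat.mem_antidiagonalTuple)

/-- The multidegree of the sheaf `𝒪_(X_q)`, whose restrictions to the components are
`𝒪(-A), 𝒪(A), 𝒪` for `q = 0`, `𝒪(A), 𝒪(-A-B), 𝒪(B)` for `q = 1` and `𝒪, 𝒪(B), 𝒪(-B)` for
`q = 2`. -/
def twist : Fin 3 → Fin 3 → ℤ := ![![-1, 1, 0], ![1, -2, 1], ![0, 1, -1]]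

/-- `w` is the multidegree `v` plus the multidegree of `𝒪_(X_q)`. -/
def IsTwist {d : ℕ} (q : Fin 3) (v w : Multidegree d) : Prop :=
  ∀ p, (w.1 p : ℤ) = (v.1 p : ℤ) + twist q p

/-- A path of nonnegative multidegrees from `u`: consecutive terms differ by plus (`up`) or minus
(`down`) the multidegree of some `𝒪_(X_q)`. -/
inductive Path {d : ℕ} (u : Multidegree d) : Multidegree d → Type
  | nil : Path u u
  | up {v w : Multidegree d} (p : Path u v) (q : Fin 3) (h : IsTwist q v w) : Path u w
  | down {v w : Multidegree d} (p : Path u v) (q : Fin 3) (h : IsTwist q w v) : Path u w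

/-- The indices `q` such that some step of the path adds the multidegree of `𝒪_(X_q)`. -/
def Path.ups {d : ℕ} {u w : Multidegree d} : Path u w → Set (Fin 3)
  | .nil => ∅
  | .up p q _ => insert q p.ups
  | .down p _ _ => p.ups

/-- The indices `q` such that some step of the path subtracts the multidegree of `𝒪_(X_q)`. -/
def Path.downs {d : ℕ} {u w : Multidegree d} : Path u w → Set (Fin 3)
  | .nil => ∅
  | .up p _ _ => p.downs
  | .down p q _ => insert q p.downs

/-- The path satisfies none of the three conditions which force the composition of the linking maps
along it to vanish: (I) the multidegrees of all three `𝒪_(X_q)` are added, (II) the multidegree of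
the same `𝒪_(X_q)` is both added and subtracted, (III) those of two different `𝒪_(X_q)` are
subtracted. -/
def Path.Admissible {d : ℕ} {u w : Multidegree d} (p : Path u w) : Prop :=
  ¬ (∀ q, q ∈ p.ups) ∧
  ¬ (∃ q, q ∈ p.ups ∧ q ∈ p.downs) ∧
  ¬ (∃ q₁ q₂, q₁ ≠ q₂ ∧ q₁ ∈ p.downs ∧ q₂ ∈ p.downs)

/-! ### Limit linear series -/

/-- The sheaves `ℒ_v` and the linking maps `φ v w : ℒ_v ⟶ ℒ_w` between the sheaves of adjacent
multidegrees (for other pairs `φ v w` is arbitrary and is never used). The last three fields are the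
three properties by which the linking maps are specified. The first two of them imply that, when
`w` is `v` plus the multidegree of `𝒪_(X_q)`, the sheaf `ℒ_w` has the restrictions
`ℒ_v(-X_q ∩ X_qᶜ)` on `X_q` and `ℒ_v(X_q ∩ X_qᶜ)` on `X_qᶜ`, so that `ℒ_w ≅ ℒ_v ⊗ 𝒪_(X_q)` and all
the sheaves are the twists of the sheaf of multidegree `(d, 0, 0)`. -/
structure LinkedSheaves {k : Type u} [Field k] (C : ChainCurve k) (d : ℕ) where
  L : Multidegree d → C.X.Modules
  invertible : ∀ v, IsInvertibleSheaf (L v)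
  multidegree : ∀ v q, HasDegreeAlong (C.ι q) (L v) (v.1 q)
  φ : ∀ v w, L v ⟶ L w
  up_factors : ∀ v w q, IsTwist q v w → C.FactorsThroughRestriction {q}ᶜ (φ v w)
  down_factors : ∀ v w q, IsTwist q v w → C.FactorsThroughRestriction {q} (φ w v)
  comp_eq : ∀ v₁ v₂ v₃ q₁ q₂, q₁ ≠ q₂ → IsTwist q₁ v₁ v₂ → IsTwist q₂ v₂ v₃ →
    φ v₁ v₂ ≫ φ v₂ v₃ = φ v₁ v₃

namespace LinkedSheaves

variable {k : Type u} [Field k] {C : ChainCurve k} {d : ℕ} (S : LinkedSheaves C d)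

/-- The space of global sections of `ℒ_v`. -/
abbrev H (v : Multidegree d) : Type u := C.H0 (S.L v)

/-- The composition, on global sections, of the linking maps along a path. -/
def pathMap {u : Multidegree d} : {w : Multidegree d} → Path u w → (S.H u →ₗ[k] S.H w)
  | _, .nil => LinearMap.id
  | _, .up (v := v) (w := w) p _ _ => C.H0map (S.φ v w) ∘ₗ pathMap p
  | _, .down (v := v) (w := w) p _ _ => C.H0map (S.φ v w) ∘ₗ pathMap p

open Classical in
/-- The map `φ_{u,w}` on global sections for arbitrary multidegrees `u` and `w`: the composition of
the linking maps along any path from `u` to `w` satisfying none of the conditions (I), (II), (III).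
For `u = w` the only such path is the empty one, which gives the identity. -/
def transport (u w : Multidegree d) : S.H u →ₗ[k] S.H w :=
  if h : ∃ p : Path u w, p.Admissible then S.pathMap h.choose else 0

end LinkedSheaves

/-- A limit linear series of degree `d` and dimension `r` on the curve `C`. -/
structure LimitLinearSeries {k : Type u} [Field k] (C : ChainCurve k) (d r : ℕ) extends
    LinkedSheaves C d where
  V : ∀ v, Submodule k (toLinkedSheaves.H v)
  finrank_V : ∀ v, Module.finrank k (V v) = r + 1
  up_linked : ∀ v w q, IsTwist q v w → (V v).map (C.H0map (φ v w)) ≤ V w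
  down_linked : ∀ v w q, IsTwist q v w → (V w).map (C.H0map (φ w v)) ≤ V v

namespace LimitLinearSeries

variable {k : Type u} [Field k] {C : ChainCurve k} {d r : ℕ} (g : LimitLinearSeries C d r)

/-- The subspace `V_v^{X_q,0}` of the sections in `V_v` that vanish on the component `X_q`. -/
def vanishingOn (v : Multidegree d) (q : Fin 3) : Submodule k (g.H v) :=
  g.V v ⊓ C.vanishing {q} (g.L v)

/-- The sum `V_v^{X₁,0} + V_v^{X₂,0} + V_v^{X₃,0}`. -/
def vanishingSum (v : Multidegree d) : Submodule k (g.H v) :=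
  g.vanishingOn v 0 ⊔ g.vanishingOn v 1 ⊔ g.vanishingOn v 2

/-- A simple basis of the limit linear series: distinct multidegrees `deg α` and for each of them a
nonempty list of linearly independent sections in `V_{deg α}`, such that for every multidegree `v`
the images of all these sections under the maps `φ_{deg α, v}` form a basis of `V_v`. -/
structure SimpleBasis where
  m : ℕ
  deg : Fin m → Multidegree d
  deg_injective : Function.Injective deg
  rk : Fin m → ℕ
  rk_pos : ∀ α, 0 < rk α
  s : ∀ α, Fin (rk α) → g.H (deg α)
  s_mem : ∀ α j, s α j ∈ g.V (deg α)
  s_linearIndependent : ∀ α, LinearIndependent k (s α)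
  images_linearIndependent : ∀ v,
    LinearIndependent k (fun p : Σ α, Fin (rk α) => g.transport (deg p.1) v (s p.1 p.2))
  images_span : ∀ v,
    Submodule.span k
      (Set.range fun p : Σ α, Fin (rk α) => g.transport (deg p.1) v (s p.1 p.2)) = g.V v

/-- A limit linear series is simple if it has a simple basis. -/
def IsSimple : Prop := Nonempty g.SimpleBasis

end LimitLinearSeries

end LimitLinear

end

noncomputable section

namespace LimitLinear

/-! ### Frames and sections of `I · M` -/

/-! The crux is `vanishingSum_eq`: for a simple basis, the sum of the three spaces of sections
vanishing on a component is the span in `V_v` of the basis images coming from multidegrees other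
than `v`. Independence of the images then makes the sections placed at `v` a basis of a complement,
which gives the second claim. The quotient at `v` has dimension the number of basis sections placed
at `v`, and summing over `v` counts the whole basis.

An image from another multidegree has passed through a last linking map, and the image of any
linking map vanishes on some component. Conversely, let `s` in `V_v` vanish on a component. Unless
`s = 0`, some linking map from `v` to an adjacent `w` kills it (`eq_zero_or_exists_link_eq_zero`):
the natural map is missing only when the twisted multidegree has a negative entry, and then a
component of degree zero forces `s` to vanish on more components. That linking map sends each basis
image at `v` to 0 or to the corresponding image at `w`, and does not kill those of sections placed
at `v`. Independence in `V_w` removes their coefficients from `s` (`coeff_eq_zero`).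

This uses the fact that following a transport by one more linking map gives 0 or the transport
again. Inadmissible paths compose to zero because the result vanishes on every component of a
reduced curve; admissible paths with the same ends agree by a confluence argument on lattice paths
(`Reach.unique`). -/

lemma IsFrame.restrict {X : Scheme.{u}} {M : X.Modules} {U V : X.Opens} {e : Γ(M, U)}
    (he : IsFrame e) (h : V ≤ U) : IsFrame (M.presheaf.map (homOfLE h).op e) := by
  intro W hW
  simpa only [map_map] using he W (hW.trans h)

/-- A section of `I · M` has coefficient in `I` with respect to a frame. -/
lemma IsFrame.exists_smul_eq_of_mem {X : Scheme.{u}} {M : X.Modules} {U : X.Opens} {e : Γ(M, U)}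
    (he : IsFrame e) {I : Ideal Γ(X, U)} {s : Γ(M, U)}
    (hs : s ∈ I • (⊤ : Submodule Γ(X, U) Γ(M, U))) : ∃ f ∈ I, s = f • e := by
  induction hs using Submodule.smul_induction_on' with
  | smul r hr t ht =>
    obtain ⟨f, hf⟩ := (he U le_rfl).2 t
    refine ⟨r * f, I.mul_mem_right _ hr, ?_⟩
    have hid : M.presheaf.map (homOfLE (le_refl U)).op e = e :=
      congr($(M.presheaf.map_id (.op U)) e)
    simp only [hid] at hf
    rw [← hf, mul_smul]
  | add x _ y _ hx hy =>
    obtain ⟨f, hf, rfl⟩ := hx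
    obtain ⟨g, hg, rfl⟩ := hy
    exact ⟨f + g, I.add_mem hf hg, (add_smul _ _ _).symm⟩

/-- If `s = g • e` with `e` a frame and `s` lies in `I · M`, then `g` lies locally in `I`. -/
lemma LiesIn.exists_coeff_mem {X : Scheme.{u}} {I : ∀ W : X.Opens, Ideal Γ(X, W)}
    (hI : ∀ (V W : X.Opens) (h : W ≤ V) (f : Γ(X, V)), f ∈ I V →
      X.presheaf.map (homOfLE h).op f ∈ I W)
    {M : X.Modules} {U W : X.Opens} {s : Γ(M, U)} (hs : LiesIn I s) (h : W ≤ U) {e : Γ(M, W)}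
    (he : IsFrame e) {g : Γ(X, W)} (hg : M.presheaf.map (homOfLE h).op s = g • e) {x : X}
    (hx : x ∈ W) :
    ∃ (W' : X.Opens) (_ : x ∈ W') (h' : W' ≤ W), X.presheaf.map (homOfLE h').op g ∈ I W' := by
  obtain ⟨W₁, hx₁, h₁, hs⟩ := hs x (h hx)
  refine ⟨W ⊓ W₁, ⟨hx, hx₁⟩, inf_le_left, ?_⟩
  have hs' := map_mem_smul_top hI (inf_le_right : W ⊓ W₁ ≤ W₁) hs
  rw [map_map, ← map_map h (inf_le_left : W ⊓ W₁ ≤ W), hg, Scheme.Modules.map_smul] at hs'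
  have he' := he.restrict (inf_le_left : W ⊓ W₁ ≤ W)
  obtain ⟨f, hf, h2⟩ := he'.exists_smul_eq_of_mem hs'
  have h3 := (he _ inf_le_left).1 h2
  exact h3 ▸ hf

lemma IsInvertibleSheaf.exists_eq_smul {X : Scheme.{u}} {M : X.Modules}
    (hM : IsInvertibleSheaf M) {U : X.Opens} (s : Γ(M, U)) {x : X} (hx : x ∈ U) :
    ∃ (W : X.Opens) (_ : x ∈ W) (h : W ≤ U) (e : Γ(M, W)) (g : Γ(X, W)), IsFrame e ∧
      M.presheaf.map (homOfLE h).op s = g • e := by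
  obtain ⟨V, hV, e, he⟩ := hM x
  have he' := he.restrict (inf_le_right : U ⊓ V ≤ V)
  obtain ⟨g, hg⟩ := (he _ (inf_le_right : U ⊓ V ≤ V)).2
    (M.presheaf.map (homOfLE (inf_le_left : U ⊓ V ≤ U)).op s)
  exact ⟨U ⊓ V, ⟨hx, hV⟩, inf_le_left, _, g, he', hg.symm⟩

lemma LiesIn.mono {X : Scheme.{u}} {I J : ∀ W : X.Opens, Ideal Γ(X, W)} (hIJ : ∀ W, I W ≤ J W)
    {M : X.Modules} {U : X.Opens} {s : Γ(M, U)} (hs : LiesIn I s) : LiesIn J s := by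
  intro x hx
  obtain ⟨W, hx, h, hs⟩ := hs x hx
  exact ⟨W, hx, h, Submodule.smul_mono_left (hIJ W) hs⟩

lemma app_map {X : Scheme.{u}} {M N : X.Modules} (φ : M ⟶ N) {U V : X.Opens} (h : V ≤ U)
    (s : Γ(M, U)) :
    N.presheaf.map (homOfLE h).op (φ.app U s) = φ.app V (M.presheaf.map (homOfLE h).op s) :=
  (congr($(φ.mapPresheaf.naturality (homOfLE h).op) s)).symm

lemma LiesIn.app {X : Scheme.{u}} {I : ∀ W : X.Opens, Ideal Γ(X, W)} {M N : X.Modules}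
    (φ : M ⟶ N) {U : X.Opens} {s : Γ(M, U)} (hs : LiesIn I s) : LiesIn I (φ.app U s) := by
  intro x hx
  obtain ⟨W, hx, h, hs⟩ := hs x hx
  refine ⟨W, hx, h, ?_⟩
  rw [app_map]
  generalize M.presheaf.map (homOfLE h).op s = t at hs ⊢
  induction hs using Submodule.smul_induction_on' with
  | smul r hr t ht =>
    rw [Scheme.Modules.Hom.app_smul]
    exact Submodule.smul_mem_smul hr trivial
  | add x _ y _ hx hy =>
    rw [map_add]
    exact add_mem hx hy

/-- The section `s` of an invertible sheaf lying in `I · M` and `J · M` lies in `(I ∩ J) · M`. -/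
lemma LiesIn.inf {X : Scheme.{u}} {I J : ∀ W : X.Opens, Ideal Γ(X, W)}
    (hI : ∀ (V W : X.Opens) (h : W ≤ V) (f : Γ(X, V)), f ∈ I V →
      X.presheaf.map (homOfLE h).op f ∈ I W)
    (hJ : ∀ (V W : X.Opens) (h : W ≤ V) (f : Γ(X, V)), f ∈ J V →
      X.presheaf.map (homOfLE h).op f ∈ J W)
    {M : X.Modules} (hM : IsInvertibleSheaf M) {U : X.Opens} {s : Γ(M, U)}
    (hs : LiesIn I s) (hs' : LiesIn J s) : LiesIn (fun W => I W ⊓ J W) s := by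
  intro x hx
  obtain ⟨W, hxW, h, e, g, he, hg⟩ := hM.exists_eq_smul s hx
  -- In a frame, membership of `s` in `I · M` and in `J · M` concerns one and the same coefficient,
  -- so it passes to the intersection; this is where invertibility enters.
  obtain ⟨W₁, hx₁, h₁, hg₁⟩ := hs.exists_coeff_mem hI h he hg hxW
  obtain ⟨W₂, hx₂, h₂, hg₂⟩ := hs'.exists_coeff_mem hJ h he hg hxW
  refine ⟨W₁ ⊓ W₂, ⟨hx₁, hx₂⟩, (inf_le_left.trans h₁).trans h, ?_⟩
  rw [← map_map h (inf_le_left.trans h₁), hg, Scheme.Modules.map_smul]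
  refine Submodule.smul_mem_smul ⟨?_, ?_⟩ trivial
  · have := hI _ (W₁ ⊓ W₂) inf_le_left _ hg₁
    rwa [← ConcreteCategory.comp_apply, ← X.presheaf.map_comp] at this
  · have := hJ _ (W₁ ⊓ W₂) inf_le_right _ hg₂
    rwa [← ConcreteCategory.comp_apply, ← X.presheaf.map_comp] at this

lemma LiesIn.eq_zero {X : Scheme.{u}} {I : ∀ W : X.Opens, Ideal Γ(X, W)}
    (hI : ∀ W, I W = ⊥) {M : X.Modules} {U : X.Opens} {s : Γ(M, U)} (hs : LiesIn I s) : s = 0 := by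
  choose W hxW hW hsW using fun x : U => hs x.1 x.2
  refine TopCat.Sheaf.eq_of_locally_eq' ⟨M.presheaf, M.isSheaf⟩ W U (fun x => homOfLE (hW x))
    (fun x hx => TopologicalSpace.Opens.mem_iSup.2 ⟨⟨x, hx⟩, hxW _⟩) s 0 fun x => ?_
  have := hsW x
  rw [hI, Submodule.bot_smul, Submodule.mem_bot] at this
  exact this.trans (map_zero _).symm

/-! ### Sections vanishing on unions of components -/

namespace ChainCurve

variable {k : Type u} [Field k] (C : ChainCurve k)

/-- The non-vanishing locus of such a function misses every component, hence is empty, and on a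
reduced scheme the function is then zero. -/
lemma ideal_univ (W : C.X.Opens) : C.ideal Set.univ W = ⊥ := by
  have := C.isReduced
  refine eq_bot_iff.2 fun f hf => ?_
  simp only [ideal, idealOf, Submodule.mem_iInf, RingHom.mem_ker] at hf
  rw [Submodule.mem_bot, ← AlgebraicGeometry.basicOpen_eq_bot_iff]
  refine eq_bot_iff.2 fun x hx => ?_
  obtain ⟨q, y, rfl⟩ := C.exists_mem_range x
  have h1 : y ∈ (C.ι q) ⁻¹ᵁ (C.X.basicOpen f) := hx
  rw [Scheme.preimage_basicOpen] at h1
  erw [hf q trivial] at h1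
  simp at h1

variable {C}

lemma VanishesOn.union {S T : Set (Fin 3)} {M : C.X.Modules} (hM : IsInvertibleSheaf M)
    {U : C.X.Opens} {s : Γ(M, U)} (hS : C.VanishesOn S s) (hT : C.VanishesOn T s) :
    C.VanishesOn (S ∪ T) s := by
  refine LiesIn.mono (fun W => ?_) (LiesIn.inf (C.ideal_map S) (C.ideal_map T) hM hS hT)
  simp only [ideal, iInf_union]
  exact le_rfl

lemma VanishesOn.mono {S T : Set (Fin 3)} (hST : S ⊆ T) {M : C.X.Modules} {U : C.X.Opens}
    {s : Γ(M, U)} (hs : C.VanishesOn T s) : C.VanishesOn S s :=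
  LiesIn.mono (fun _ => biInf_mono hST) hs

lemma VanishesOn.eq_zero {S : Set (Fin 3)} (hS : ∀ q, q ∈ S) {M : C.X.Modules} {U : C.X.Opens}
    {s : Γ(M, U)} (hs : C.VanishesOn S s) : s = 0 :=
  LiesIn.eq_zero C.ideal_univ (VanishesOn.mono (fun q _ => hS q) hs)

end ChainCurve

/-! ### Orders of vanishing -/

/-- The order of `a` is the length of `R/(a)`, which is nonzero when `a` is not a unit. Values are
multiplicative, so order zero corresponds to `1`. -/
lemma one_lt_ordFrac {R K : Type*} [CommRing R] [IsDomain R] [IsNoetherianRing R]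
    [Ring.KrullDimLE 1 R] [Field K] [Algebra R K] [IsFractionRing R K] {a : R} (ha : a ≠ 0)
    (hu : ¬ IsUnit a) : 1 < Ring.ordFrac R (algebraMap R K a) := by
  rw [Ring.ordFrac_eq_ord R ha]
  have hz := mem_nonZeroDivisors_of_ne_zero ha
  obtain ⟨n, hn⟩ := ENat.ne_top_iff_exists.1 (Ring.ord_ne_top hz)
  rw [Ring.ordMonoidWithZeroHom_eq_coe R hz hn.symm]
  have hpos : 0 < n := by
    rw [Nat.pos_iff_ne_zero]
    rintro rfl
    have h0 : Ring.ord R a = 0 := by rw [← hn]; rfl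
    rw [Ring.ord, Module.length_eq_zero_iff, Ideal.Quotient.subsingleton_iff,
      Ideal.span_singleton_eq_top] at h0
    exact hu h0
  rw [← WithZero.coe_one, WithZero.coe_lt_coe, ← ofAdd_zero, Multiplicative.ofAdd_lt]
  exact_mod_cast hpos

/-- A local ring with a nonzero nonunit is not a field, which rules out the generic point.
Codimension one is needed since `Scheme.ord` is zero elsewhere by convention. -/
lemma coheight_eq_one_of_nonunit_germ {X : Scheme.{u}} [IsIntegral X]
    (hX : topologicalKrullDim X = 1) {x : X} {a : X.presheaf.stalk x} (ha : a ≠ 0)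
    (hu : ¬ IsUnit a) : Order.coheight x = 1 := by
  apply le_antisymm
  · have h1 : Order.krullDim X = 1 := by
      rw [← hX, topologicalKrullDim]
      exact (Order.krullDim_eq_of_orderIso irreducibleSetEquivPoints).symm
    have h2 := Order.coheight_le_krullDim x
    rw [h1] at h2
    exact_mod_cast h2
  · rw [Order.one_le_iff_ne_zero]
    intro h0
    have h1 : Ring.KrullDimLE 0 (X.presheaf.stalk x) :=
      krullDimLE_of_coheight_le (by rw [h0]; rfl)
    exact hu ((Ring.KrullDimLE.isField_of_isDomain (R := X.presheaf.stalk x)).mul_inv_cancel ha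
      |>.elim fun b hb => IsUnit.of_mul_eq_one b hb)

lemma ord_nonneg_of_section {X : Scheme.{u}} [IsIntegral X] [IsLocallyNoetherian X] {U : X.Opens}
    [Nonempty U] {x : X} (hx : x ∈ U) {a : Γ(X, U)} (ha : X.germToFunctionField U a ≠ 0) :
    0 ≤ Scheme.ord (X.germToFunctionField U a) x := by
  have ha' : a ≠ 0 := by
    rintro rfl
    exact ha (map_zero _)
  have h1 : Scheme.ord (1 : X.functionField) x = 0 := by
    have := Scheme.ord_of_isUnit (isUnit_one (M := Γ(X, U))) hx
    rwa [map_one] at this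
  have h2 := Scheme.ord_le_smul hx ha' (1 : X.functionField)
  rwa [h1, Algebra.smul_def, mul_one] at h2

lemma ord_pos_of_section {X : Scheme.{u}} [IsIntegral X] [IsLocallyNoetherian X]
    (hX : topologicalKrullDim X = 1) {U : X.Opens}
    [Nonempty U] {x : X} (hx : x ∈ U) {a : Γ(X, U)} (ha : X.germToFunctionField U a ≠ 0)
    (hu : x ∉ X.basicOpen a) : 0 < Scheme.ord (X.germToFunctionField U a) x := by
  have hu' : ¬ IsUnit (X.presheaf.germ U x hx a) := by rwa [← X.mem_basicOpen _ _ hx]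
  have ha' : X.presheaf.germ U x hx a ≠ 0 := by
    intro h0
    rw [← Scheme.algebraMap_germ_eq_germToFunctionField _ hx, h0, map_zero] at ha
    exact ha rfl
  have hco := coheight_eq_one_of_nonunit_germ hX ha' hu'
  have : Ring.KrullDimLE 1 (X.presheaf.stalk x) := krullDimLE_of_coheight_le hco.le
  have h1 := one_lt_ordFrac (K := X.functionField) ha' hu'
  rw [Scheme.algebraMap_germ_eq_germToFunctionField] at h1
  by_contra! hle
  have h2 : Scheme.ord (X.germToFunctionField U a) x ≤ 0 := hle
  have h3 := (Scheme.ord_eq_iff hco ha).1 rfl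
  rw [Scheme.ordHom] at h3
  rw [h3, ← WithZero.coe_one, WithZero.coe_lt_coe, ← ofAdd_zero, Multiplicative.ofAdd_lt] at h1
  omega

/-! ### Components of degree zero and the nodes -/

namespace ChainCurve
variable {k : Type u} [Field k] {C : ChainCurve k}

/-- A global section of an invertible sheaf of degree zero on `X_q` which vanishes on a component
meeting `X_q` also vanishes on `X_q`. -/
lemma vanishesOn_of_degree_zero {M : C.X.Modules} {p q : Fin 3}
    (hpq : ∃ x, ∃ y, C.ι q x = C.ι p y) (hdeg : HasDegreeAlong (C.ι q) M 0)
    {s : Γ(M, (⊤ : C.X.Opens))} (hs : C.VanishesOn {p} s) : C.VanishesOn {q} s := by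
  have hone : ∀ q W, C.ideal {q} W = idealOf (C.ι q) W := fun q W => by simp [ideal]
  -- Otherwise the divisor of `s` on `X_q` is effective, and it is positive at a point shared with
  -- `X_p`, where the local coefficient of `s` lies in the ideal of `X_p`. Its degree would be
  -- positive.
  by_contra hns
  have hns' : ¬ LiesIn (idealOf (C.ι q)) s := fun h => hns (h.mono fun W => (hone q W).ge)
  obtain ⟨D, hD, hfin, hsum⟩ := hdeg ⊤ s hns'
  have hnonneg : ∀ x, 0 ≤ D x := by
    intro x
    obtain ⟨W, hxW, e, g, hne, he, hg, h0, hord⟩ := hD x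
    rw [← hord]
    exact ord_nonneg_of_section (U := C.ι q ⁻¹ᵁ (⊤ ⊓ W)) (x := x) ⟨trivial, hxW⟩ h0
  obtain ⟨x, y, hxy⟩ := hpq
  have hpos : 0 < D x := by
    obtain ⟨W, hxW, e, g, hne, he, hg, h0, hord⟩ := hD x
    rw [← hord]
    refine ord_pos_of_section (C.dim_eq_one q) (U := C.ι q ⁻¹ᵁ (⊤ ⊓ W)) (x := x)
      ⟨trivial, hxW⟩ h0 ?_
    obtain ⟨W', hxW', h', hg'⟩ := hs.exists_coeff_mem (C.ideal_map {p}) inf_le_left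
      (he.restrict (inf_le_right : ⊤ ⊓ W ≤ W)) hg (x := C.ι q x) ⟨trivial, hxW⟩
    rw [hone, idealOf, RingHom.mem_ker] at hg'
    have hb : (C.ι q) ⁻¹ᵁ (C.X.basicOpen g) = (C.comp q).basicOpen ((C.ι q).app _ g) :=
      Scheme.preimage_basicOpen _ _
    intro hx
    erw [← hb] at hx
    have hy : C.ι p y ∈ C.X.basicOpen (C.X.presheaf.map (homOfLE h').op g) := by
      rw [Scheme.basicOpen_res, ← hxy]
      exact ⟨hxW', hx⟩
    have hy' : y ∈ (C.ι p) ⁻¹ᵁ (C.X.basicOpen (C.X.presheaf.map (homOfLE h').op g)) := hy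
    rw [Scheme.preimage_basicOpen] at hy'
    erw [hg'] at hy'
    simp at hy'
  have := finsum_pos hnonneg ⟨x, hpos⟩ hfin
  omega

/-- The fibre product is isomorphic to `Spec k`, so it has a point. -/
lemma exists_node {p q : Fin 3} {f : Limits.pullback (C.ι p) (C.ι q) ⟶ Spec (.of k)}
    (h : IsIso f) : ∃ x y, C.ι q x = C.ι p y := by
  let z := (inv f) (⊥ : PrimeSpectrum k)
  refine ⟨Limits.pullback.snd (C.ι p) (C.ι q) z, Limits.pullback.fst (C.ι p) (C.ι q) z, ?_⟩
  rw [← Scheme.Hom.comp_apply, ← Scheme.Hom.comp_apply, Limits.pullback.condition]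

variable (C) in
lemma exists_node_01 : ∃ x y, C.ι 1 x = C.ι 0 y := exists_node C.nodeA

variable (C) in
lemma exists_node_12 : ∃ x y, C.ι 2 x = C.ι 1 y := exists_node C.nodeB

end ChainCurve

/-! ### Composition of linking maps along admissible paths -/

lemma IsTwist.right_unique {d : ℕ} {q : Fin 3} {v w w' : Multidegree d} (h : IsTwist q v w)
    (h' : IsTwist q v w') : w = w' := by
  ext p
  have := h p
  have := h' p
  omega

lemma IsTwist.left_unique {d : ℕ} {q : Fin 3} {v v' w : Multidegree d} (h : IsTwist q v w)
    (h' : IsTwist q v' w) : v = v' := by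
  ext p
  have := h p
  have := h' p
  omega

lemma sum_twist (q : Fin 3) : ∑ p, twist q p = 0 := by
  fin_cases q <;> simp [twist, Fin.sum_univ_three]

lemma twist_add {i j m : Fin 3} (hij : i ≠ j) (hi : i ≠ m) (hj : j ≠ m) (p : Fin 3) :
    twist i p + twist j p + twist m p = 0 := by
  revert i j m p
  decide

/-- A triple of nonnegative integers that differs from a multidegree by a multidegree of total
degree zero. -/
lemma exists_multidegree {d : ℕ} (w : Multidegree d) (f : Fin 3 → ℤ) (hf : ∀ p, 0 ≤ w.1 p + f p)
    (hsum : ∑ p, f p = 0) : ∃ v : Multidegree d, ∀ p, (v.1 p : ℤ) = w.1 p + f p := by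
  refine ⟨⟨fun p => ((w.1 p : ℤ) + f p).toNat, ?_⟩, fun p => Int.toNat_of_nonneg (hf p)⟩
  have := w.2
  zify at this ⊢
  rw [Finset.sum_congr rfl fun p _ => Int.toNat_of_nonneg (hf p), Finset.sum_add_distrib, hsum, this,
    add_zero]

namespace LinkedSheaves

variable {k : Type u} [Field k] {C : ChainCurve k} {d : ℕ} (S : LinkedSheaves C d)

/-- The map on global sections induced by the linking map. -/
abbrev link (v w : Multidegree d) : S.H v →ₗ[k] S.H w := C.H0map (S.φ v w)

lemma link_comp {v₁ v₂ v₃ : Multidegree d} {q₁ q₂ : Fin 3} (hq : q₁ ≠ q₂) (h₁ : IsTwist q₁ v₁ v₂)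
    (h₂ : IsTwist q₂ v₂ v₃) : S.link v₂ v₃ ∘ₗ S.link v₁ v₂ = S.link v₁ v₃ := by
  rw [link, link, link, ← S.comp_eq _ _ _ _ _ hq h₁ h₂]
  rfl

/-- `S.Reach i j m u a b w f` holds when `f` is the composition of the linking maps along a path
from `u` to `w` whose steps add the twist by `i`, add the twist by `j` or subtract the twist by `m`,
where `{i, j, m}` are the three indices; subtracting the twist by `m` amounts to adding both others,
and `a`, `b` are the resulting numbers of twists by `i` and by `j`. -/
inductive Reach (i j m : Fin 3) (u : Multidegree d) :
    ℕ → ℕ → (w : Multidegree d) → (S.H u →ₗ[k] S.H w) → Prop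
  | nil : Reach i j m u 0 0 u LinearMap.id
  | left {a b : ℕ} {v w : Multidegree d} {f : S.H u →ₗ[k] S.H v} (hf : Reach i j m u a b v f)
      (h : IsTwist i v w) : Reach i j m u (a + 1) b w (S.link v w ∘ₗ f)
  | right {a b : ℕ} {v w : Multidegree d} {f : S.H u →ₗ[k] S.H v} (hf : Reach i j m u a b v f)
      (h : IsTwist j v w) : Reach i j m u a (b + 1) w (S.link v w ∘ₗ f)
  | diag {a b : ℕ} {v w : Multidegree d} {f : S.H u →ₗ[k] S.H v} (hf : Reach i j m u a b v f)
      (h : IsTwist m w v) : Reach i j m u (a + 1) (b + 1) w (S.link v w ∘ₗ f)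

variable {S}

namespace Reach

variable {i j m : Fin 3} {u w : Multidegree d} {a b : ℕ} {f : S.H u →ₗ[k] S.H w}

lemma eq_add (hij : i ≠ j) (hi : i ≠ m) (hj : j ≠ m) (hf : S.Reach i j m u a b w f) (p : Fin 3) :
    (w.1 p : ℤ) = u.1 p + a * twist i p + b * twist j p := by
  induction hf with
  | nil => simp
  | left hf h ih => rw [h p, ih]; push_cast; ring
  | right hf h ih => rw [h p, ih]; push_cast; ring
  | diag hf h ih =>
    have := h p
    have := twist_add hij hi hj p
    push_cast
    linarith

/-- With no twist by `i` only steps by `j` occur, so the roles of `i` and `m` are immaterial. This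
compares descriptions that omit different indices. -/
lemma of_zero (i' m' : Fin 3) (hf : S.Reach i j m u 0 b w f) : S.Reach i' j m' u 0 b w f := by
  generalize ha : 0 = a at hf
  induction hf with
  | nil => exact .nil
  | left hf h ih => omega
  | right hf h ih => exact (ih ha).right h
  | diag hf h ih => omega

/-- The last step of a path in reverse: a neighbour of `w` closer to `u`. -/
lemma exists_previous (hij : i ≠ j) (hi : i ≠ m) (hj : j ≠ m) {u w : Multidegree d}
    (h : ∀ p, (w.1 p : ℤ) = u.1 p + a * twist i p + b * twist j p) (hab : 0 < a + b) :
    (∃ v : Multidegree d, IsTwist i v w ∧ 0 < a) ∨ (∃ v : Multidegree d, IsTwist j v w ∧ 0 < b) ∨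
      ∃ v : Multidegree d, IsTwist m w v ∧ 0 < a ∧ 0 < b := by
  -- One of the three candidate predecessors `w - e_i`, `w - e_j`, `w + e_m` is nonnegative, since
  -- `u` is; this is linear arithmetic for each labelling of the indices.
  have key : (0 < a ∧ ∀ p, 0 ≤ (w.1 p : ℤ) + -twist i p) ∨
      (0 < b ∧ ∀ p, 0 ≤ (w.1 p : ℤ) + -twist j p) ∨
      (0 < a ∧ 0 < b ∧ ∀ p, 0 ≤ (w.1 p : ℤ) + twist m p) := by
    have h0 := h 0
    have h1 := h 1
    have h2 := h 2
    simp only [Fin.forall_fin_succ]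
    clear h
    fin_cases i <;> fin_cases j <;> fin_cases m <;> simp [twist] at * <;> omega
  rcases key with ⟨ha, h'⟩ | ⟨hb, h'⟩ | ⟨ha, hb, h'⟩
  · obtain ⟨v, hv⟩ := exists_multidegree w _ h' (by rw [Finset.sum_neg_distrib, sum_twist, neg_zero])
    exact Or.inl ⟨v, fun p => by rw [hv]; ring, ha⟩
  · obtain ⟨v, hv⟩ := exists_multidegree w _ h' (by rw [Finset.sum_neg_distrib, sum_twist, neg_zero])
    exact Or.inr (Or.inl ⟨v, fun p => by rw [hv]; ring, hb⟩)
  · obtain ⟨v, hv⟩ := exists_multidegree w _ h' (sum_twist m)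
    exact Or.inr (Or.inr ⟨v, fun p => hv p, ha, hb⟩)

/-- Step back from `w` to a nonnegative predecessor. A diagonal step lowers `a + b` by two, hence
strong induction. -/
lemma exists_of_eq_add (S : LinkedSheaves C d) (hij : i ≠ j) (hi : i ≠ m) (hj : j ≠ m) (n : ℕ) :
    ∀ {a b : ℕ} {u w : Multidegree d}, a + b = n →
    (∀ p, (w.1 p : ℤ) = u.1 p + a * twist i p + b * twist j p) →
    ∃ f, S.Reach i j m u a b w f := by
  induction n using Nat.strong_induction_on with
  | _ n ih =>
  intro a b u w hn h
  rcases Nat.eq_zero_or_pos (a + b) with h0 | hpos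
  · obtain ⟨rfl, rfl⟩ : a = 0 ∧ b = 0 := by omega
    obtain rfl : w = u := by
      ext p
      have := h p
      simp at this
      omega
    exact ⟨_, .nil⟩
  rcases exists_previous hij hi hj h hpos with ⟨v, hv, ha⟩ | ⟨v, hv, hb⟩ | ⟨v, hv, ha, hb⟩
  · obtain ⟨a, rfl⟩ := Nat.exists_eq_succ_of_ne_zero ha.ne'
    obtain ⟨f, hf⟩ := ih (a + b) (by omega) (u := u) (w := v) rfl fun p => by
      have := h p
      have := hv p
      push_cast at *
      linarith
    exact ⟨_, hf.left hv⟩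
  · obtain ⟨b, rfl⟩ := Nat.exists_eq_succ_of_ne_zero hb.ne'
    obtain ⟨f, hf⟩ := ih (a + b) (by omega) (u := u) (w := v) rfl fun p => by
      have := h p
      have := hv p
      push_cast at *
      linarith
    exact ⟨_, hf.right hv⟩
  · obtain ⟨a, rfl⟩ := Nat.exists_eq_succ_of_ne_zero ha.ne'
    obtain ⟨b, rfl⟩ := Nat.exists_eq_succ_of_ne_zero hb.ne'
    obtain ⟨f, hf⟩ := ih (a + b) (by omega) (u := u) (w := v) rfl fun p => by
      have := h p
      have := hv p
      have := twist_add hij hi hj p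
      push_cast at *
      linarith
    exact ⟨_, hf.diag hv⟩

/-- If `w` is a twist of two multidegrees by `i` and by `j`, reached from `u`, it is the twist by
both of a multidegree. -/
lemma exists_corner (hij : i ≠ j) (hi : i ≠ m) (hj : j ≠ m) {u v v' w : Multidegree d}
    (h : ∀ p, (w.1 p : ℤ) = u.1 p + (a + 1 : ℕ) * twist i p + (b + 1 : ℕ) * twist j p)
    (hv : IsTwist i v w) (hv' : IsTwist j v' w) :
    ∃ t : Multidegree d, IsTwist j t v ∧ IsTwist i t v' := by
  -- The corner is `w - e_i - e_j = w + e_m`. When `i`, `j` are the two end components, the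
  -- neighbours only give a middle degree of at least one; the two is supplied by the counts `a + 1`
  -- and `b + 1`.
  have key : ∀ p, 0 ≤ (w.1 p : ℤ) + twist m p := by
    have h0 := h 0
    have h1 := h 1
    have h2 := h 2
    have g0 := hv 0
    have g1 := hv 1
    have g2 := hv 2
    have g0' := hv' 0
    have g1' := hv' 1
    have g2' := hv' 2
    simp only [Fin.forall_fin_succ]
    clear h hv hv'
    fin_cases i <;> fin_cases j <;> fin_cases m <;> simp [twist] at * <;> omega
  obtain ⟨t, ht⟩ := exists_multidegree w _ key (sum_twist m)
  refine ⟨t, fun p => ?_, fun p => ?_⟩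
  · have := hv p
    have := ht p
    have := twist_add hij hi hj p
    linarith
  · have := hv' p
    have := ht p
    have := twist_add hij hi hj p
    linarith

/-- The composition of the linking maps does not depend on the path. -/
lemma unique (hij : i ≠ j) (hi : i ≠ m) (hj : j ≠ m) (n : ℕ) :
    ∀ {a b : ℕ} {u w : Multidegree d} {f f' : S.H u →ₗ[k] S.H w}, a + b = n →
    S.Reach i j m u a b w f → S.Reach i j m u a b w f' → f = f' := by
  induction n using Nat.strong_induction_on with
  | _ n ih =>
  -- A diagonal step is a step by `j` followed by one by `i`, through `v`. Both last steps thus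
  -- factor through `v`, where induction applies.
  have diag_left : ∀ {a b : ℕ} {u v v' w : Multidegree d} {f : S.H u →ₗ[k] S.H v}
      {f' : S.H u →ₗ[k] S.H v'}, a + 1 + (b + 1) = n → S.Reach i j m u a (b + 1) v f →
      IsTwist i v w → S.Reach i j m u a b v' f' → IsTwist m w v' →
      S.link v w ∘ₗ f = S.link v' w ∘ₗ f' := by
    intro a b u v v' w f f' hn hf h hf' h'
    have hv : IsTwist j v' v := fun p => by
      have := h p
      have := h' p
      have := twist_add hij hi hj p
      linarith
    rw [ih _ (by omega) rfl hf (hf'.right hv), ← LinearMap.comp_assoc, S.link_comp hij.symm hv h]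
  have diag_right : ∀ {a b : ℕ} {u v v' w : Multidegree d} {f : S.H u →ₗ[k] S.H v}
      {f' : S.H u →ₗ[k] S.H v'}, a + 1 + (b + 1) = n → S.Reach i j m u (a + 1) b v f →
      IsTwist j v w → S.Reach i j m u a b v' f' → IsTwist m w v' →
      S.link v w ∘ₗ f = S.link v' w ∘ₗ f' := by
    intro a b u v v' w f f' hn hf h hf' h'
    have hv : IsTwist i v' v := fun p => by
      have := h p
      have := h' p
      have := twist_add hij hi hj p
      linarith
    rw [ih _ (by omega) rfl hf (hf'.left hv), ← LinearMap.comp_assoc, S.link_comp hij hv h]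
  -- Complete the two last steps to a square with corner `t`; both ways round from `t` to `w` equal
  -- the diagonal linking map.
  have left_right : ∀ {a b : ℕ} {u v v' w : Multidegree d} {f : S.H u →ₗ[k] S.H v}
      {f' : S.H u →ₗ[k] S.H v'}, a + 1 + (b + 1) = n → S.Reach i j m u a (b + 1) v f →
      IsTwist i v w → S.Reach i j m u (a + 1) b v' f' → IsTwist j v' w →
      S.link v w ∘ₗ f = S.link v' w ∘ₗ f' := by
    intro a b u v v' w f f' hn hf h hf' h'
    obtain ⟨t, ht, ht'⟩ := exists_corner hij hi hj ((hf.left h).eq_add hij hi hj) h h'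
    obtain ⟨e, he⟩ := exists_of_eq_add S hij hi hj (a + b) (u := u) (w := t) rfl fun p => by
      have := hf.eq_add hij hi hj p
      have := ht p
      push_cast at *
      linarith
    rw [ih _ (by omega) rfl hf (he.right ht), ih _ (by omega) rfl hf' (he.left ht'),
      ← LinearMap.comp_assoc, ← LinearMap.comp_assoc, S.link_comp hij.symm ht h,
      S.link_comp hij ht' h']
  intro a b u w f f' hn hf hf'
  cases hf with
  | nil =>
    cases hf'
    rfl
  | left hf h =>
    cases hf' with
    | left hf' h' =>
      obtain rfl := h.left_unique h'
      rw [ih _ (by omega) rfl hf hf']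
    | right hf' h' => exact left_right hn hf h hf' h'
    | diag hf' h' => exact diag_left hn hf h hf' h'
  | right hf h =>
    cases hf' with
    | left hf' h' => exact (left_right hn hf' h' hf h).symm
    | right hf' h' =>
      obtain rfl := h.left_unique h'
      rw [ih _ (by omega) rfl hf hf']
    | diag hf' h' => exact diag_right hn hf h hf' h'
  | diag hf h =>
    cases hf' with
    | left hf' h' => exact (diag_left hn hf' h' hf h).symm
    | right hf' h' => exact (diag_right hn hf' h' hf h).symm
    | diag hf' h' =>
      obtain rfl := h.right_unique h'
      rw [ih _ (by omega) rfl hf hf']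

end Reach
end LinkedSheaves
-- Independence of the admissible path
namespace LinkedSheaves

variable {k : Type u} [Field k] {C : ChainCurve k} {d : ℕ} {S : LinkedSheaves C d}

lemma Reach.eq_of_reach {i j m m' : Fin 3} (hij : i ≠ j) (hi : i ≠ m) (hj : j ≠ m)
    (hm : m' = m ∨ m' = i) {u w : Multidegree d} {a b a' b' : ℕ} {f f' : S.H u →ₗ[k] S.H w}
    (hf : S.Reach i j m u a b w f)
    (hf' : S.Reach (if m' = m then i else m) j m' u a' b' w f') : f = f' := by
  rcases hm with rfl | rfl
  · rw [if_pos rfl] at hf'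
    have key : a = a' ∧ b = b' := by
      have h := fun p => (hf.eq_add hij hi hj p).symm.trans (hf'.eq_add hij hi hj p)
      have h0 := h 0
      have h1 := h 1
      have h2 := h 2
      clear h hf hf'
      fin_cases i <;> fin_cases j <;> fin_cases m' <;> simp [twist] at * <;> omega
    obtain ⟨rfl, rfl⟩ := key
    exact Reach.unique hij hi hj _ rfl hf hf'
  · rw [if_neg hi] at hf'
    -- Since `e_i + e_j + e_m = 0` is the only relation up to scaling, a nonnegative combination of
    -- `e_i, e_j` equals one of `e_m, e_j` only if both are the same multiple of `e_j`.
    have key : a = 0 ∧ a' = 0 ∧ b = b' := by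
      have h := fun p => (hf.eq_add hij hi hj p).symm.trans
        (hf'.eq_add hj.symm hi.symm hij.symm p)
      have h0 := h 0
      have h1 := h 1
      have h2 := h 2
      clear h hf hf'
      fin_cases m' <;> fin_cases j <;> fin_cases m <;> simp [twist] at * <;> omega
    obtain ⟨rfl, rfl, rfl⟩ := key
    exact Reach.unique hij hi hj _ rfl hf (hf'.of_zero m' m)

lemma reach_pathMap {i j m : Fin 3} (hm : ∀ q, q = i ∨ q = j ∨ q = m)
    {u w : Multidegree d} (p : Path u w) (hup : m ∉ p.ups) (hdown : ∀ q ∈ p.downs, q = m) :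
    ∃ a b, S.Reach i j m u a b w (S.pathMap p) := by
  induction p with
  | nil => exact ⟨0, 0, .nil⟩
  | up p q h ih =>
    simp only [Path.ups, Path.downs, Set.mem_insert_iff, not_or] at hup hdown
    obtain ⟨a, b, hf⟩ := ih hup.2 hdown
    rcases hm q with rfl | rfl | rfl
    · exact ⟨_, _, hf.left h⟩
    · exact ⟨_, _, hf.right h⟩
    · exact absurd rfl hup.1
  | down p q h ih =>
    simp only [Path.ups, Path.downs, Set.mem_insert_iff, forall_eq_or_imp] at hup hdown
    obtain ⟨a, b, hf⟩ := ih hup hdown.2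
    obtain rfl := hdown.1
    exact ⟨_, _, hf.diag h⟩

/-- If an index is subtracted, it is the only one by (III) and is not added by (II). If none is, (I)
supplies an index that is not added. -/
lemma _root_.LimitLinear.Path.Admissible.exists_index {u w : Multidegree d} {p : Path u w}
    (hp : p.Admissible) : ∃ m, m ∉ p.ups ∧ ∀ q ∈ p.downs, q = m := by
  obtain ⟨h1, h2, h3⟩ := hp
  push Not at h1 h2 h3
  by_cases h : ∃ m, m ∈ p.downs
  · obtain ⟨m, hm⟩ := h
    exact ⟨m, fun h => h2 m h hm, fun q hq => by_contra fun hne => h3 q m hne hq hm⟩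
  · obtain ⟨m, hm⟩ := h1
    exact ⟨m, hm, fun q hq => absurd ⟨q, hq⟩ h⟩

lemma pathMap_eq {u w : Multidegree d} {p p' : Path u w} (hp : p.Admissible)
    (hp' : p'.Admissible) : S.pathMap p = S.pathMap p' := by
  obtain ⟨m, hm, hm'⟩ := hp.exists_index
  obtain ⟨n, hn, hn'⟩ := hp'.exists_index
  -- The indices other than `m` are named so that `n`, if different from `m`, is `i`.
  obtain ⟨i, j, hij, hi, hj, h, hall, hall'⟩ : ∃ i j : Fin 3, i ≠ j ∧ i ≠ m ∧ j ≠ m ∧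
      (n = m ∨ n = i) ∧ (∀ q, q = i ∨ q = j ∨ q = m) ∧
      ∀ q, q = (if n = m then i else m) ∨ q = j ∨ q = n := by
    clear * -
    revert m n
    decide
  obtain ⟨a, b, hf⟩ := reach_pathMap (S := S) hall p hm hm'
  obtain ⟨a', b', hf'⟩ := reach_pathMap (S := S) hall' p' hn hn'
  exact hf.eq_of_reach hij hi hj h hf'

/-! ### Vanishing of composite maps -/

/-- The image of a linking map lies in the sections vanishing on the complementary subcurve: `X_q`
when `e_q` is added and the other components when it is subtracted. -/
lemma link_mem_vanishing_up {v w : Multidegree d} {q : Fin 3} (h : IsTwist q v w) (s : S.H v) :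
    S.link v w s ∈ C.vanishing {q} (S.L w) := by
  have := ((S.up_factors v w q h).2 ⊤ (S.link v w s)).2 fun x hx =>
    ⟨⊤, hx, le_rfl, s, (congr($((S.L w).presheaf.map_id (.op ⊤)) (S.link v w s))).symm⟩
  rwa [compl_compl] at this

lemma link_mem_vanishing_down {v w : Multidegree d} {q : Fin 3} (h : IsTwist q w v) (s : S.H v) :
    S.link v w s ∈ C.vanishing {q}ᶜ (S.L w) :=
  ((S.down_factors w v q h).2 ⊤ (S.link v w s)).2 fun _ hx =>
    ⟨⊤, hx, le_rfl, s, (congr($((S.L w).presheaf.map_id (.op ⊤)) (S.link v w s))).symm⟩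

lemma link_mem_vanishing {v : Multidegree d} (w : Multidegree d) {T : Set (Fin 3)} {s : S.H v}
    (hs : s ∈ C.vanishing T (S.L v)) : S.link v w s ∈ C.vanishing T (S.L w) :=
  LiesIn.app (S.φ v w) hs

lemma pathMap_mem_vanishing_up {u w : Multidegree d} (p : Path u w) {q : Fin 3} (hq : q ∈ p.ups)
    (s : S.H u) : S.pathMap p s ∈ C.vanishing {q} (S.L w) := by
  induction p with
  | nil => exact absurd hq (Set.notMem_empty q)
  | up p q' h ih =>
    rcases hq with rfl | hq
    · exact link_mem_vanishing_up h _
    · exact link_mem_vanishing _ (ih hq)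
  | down p q' h ih => exact link_mem_vanishing _ (ih hq)

lemma pathMap_mem_vanishing_down {u w : Multidegree d} (p : Path u w) {q : Fin 3}
    (hq : q ∈ p.downs) (s : S.H u) : S.pathMap p s ∈ C.vanishing {q}ᶜ (S.L w) := by
  induction p with
  | nil => exact absurd hq (Set.notMem_empty q)
  | up p q' h ih => exact link_mem_vanishing _ (ih hq)
  | down p q' h ih =>
    rcases hq with rfl | hq
    · exact link_mem_vanishing_down h _
    · exact link_mem_vanishing _ (ih hq)

lemma vanishing_union {v : Multidegree d} {T T' : Set (Fin 3)} {s : S.H v}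
    (h : s ∈ C.vanishing T (S.L v)) (h' : s ∈ C.vanishing T' (S.L v)) :
    s ∈ C.vanishing (T ∪ T') (S.L v) :=
  ChainCurve.VanishesOn.union (S.invertible v) h h'

lemma eq_zero_of_mem_vanishing {v : Multidegree d} {T : Set (Fin 3)} (hT : ∀ q, q ∈ T) {s : S.H v}
    (h : s ∈ C.vanishing T (S.L v)) : s = 0 :=
  ChainCurve.VanishesOn.eq_zero hT h

/-- Each violation makes the image vanish on subcurves covering `X`: the three components for (I),
`X_q` and its complement for (II), the complements of two different components for (III). -/
lemma pathMap_eq_zero {u w : Multidegree d} {p : Path u w} (hp : ¬ p.Admissible) :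
    S.pathMap p = 0 := by
  ext s
  rw [Path.Admissible, not_and_or, not_and_or, not_not, not_not, not_not] at hp
  rcases hp with h | ⟨q, hq, hq'⟩ | ⟨q, q', hne, hq, hq'⟩
  · refine eq_zero_of_mem_vanishing (T := {0} ∪ ({1} ∪ {2})) (fun q => by fin_cases q <;> simp) ?_
    exact vanishing_union (pathMap_mem_vanishing_up p (h 0) s)
      (vanishing_union (pathMap_mem_vanishing_up p (h 1) s) (pathMap_mem_vanishing_up p (h 2) s))
  · exact eq_zero_of_mem_vanishing (fun x => em (x = q))
      (vanishing_union (pathMap_mem_vanishing_up p hq s) (pathMap_mem_vanishing_down p hq' s))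
  · refine eq_zero_of_mem_vanishing (fun x => ?_)
      (vanishing_union (pathMap_mem_vanishing_down p hq s) (pathMap_mem_vanishing_down p hq' s))
    by_cases hx : x = q
    · exact Or.inr (by rw [hx]; exact hne)
    · exact Or.inl hx

/-! ### The maps between arbitrary multidegrees -/

lemma transport_eq {u w : Multidegree d} {p : Path u w} (hp : p.Admissible) :
    S.transport u w = S.pathMap p := by
  have h : ∃ p : Path u w, p.Admissible := ⟨p, hp⟩
  rw [transport, dif_pos h]
  exact pathMap_eq h.choose_spec hp

variable (S) in
lemma transport_eq_pathMap_or (u w : Multidegree d) :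
    (∃ p : Path u w, S.transport u w = S.pathMap p) ∨ S.transport u w = 0 := by
  by_cases h : ∃ p : Path u w, p.Admissible
  · exact Or.inl ⟨h.choose, transport_eq h.choose_spec⟩
  · exact Or.inr (by rw [transport, dif_neg h])

lemma pathMap_eq_transport_or {u w : Multidegree d} (p : Path u w) :
    S.pathMap p = 0 ∨ S.pathMap p = S.transport u w := by
  by_cases hp : p.Admissible
  · exact Or.inr (transport_eq hp).symm
  · exact Or.inl (pathMap_eq_zero hp)

variable (S) in
lemma transport_self (v : Multidegree d) : S.transport v v = LinearMap.id :=
  transport_eq (p := .nil) (by simp [Path.Admissible, Path.ups, Path.downs])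

/-- `v` and `w` differ by plus or minus the multidegree of some `𝒪_(X_q)`. -/
def _root_.LimitLinear.Adjacent (v w : Multidegree d) : Prop := ∃ q, IsTwist q v w ∨ IsTwist q w v

lemma transport_of_adjacent {v w : Multidegree d} (h : Adjacent v w) :
    S.transport v w = S.link v w := by
  obtain ⟨q, h | h⟩ := h
  · refine transport_eq (p := .up .nil q h) ⟨fun h => ?_, ?_, ?_⟩
    · have h0 := h 0
      have h1 := h 1
      simp only [Path.ups, Set.mem_insert_iff, Set.mem_empty_iff_false, or_false] at h0 h1
      exact absurd (h0.trans h1.symm) (by decide)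
    · simp [Path.ups, Path.downs]
    · simp [Path.downs]
  · refine transport_eq (p := .down .nil q h) ⟨?_, ?_, ?_⟩
    · simp [Path.ups]
    · simp [Path.ups]
    · simp only [Path.downs, Set.mem_insert_iff, Set.mem_empty_iff_false, or_false]
      rintro ⟨q₁, q₂, hne, rfl, rfl⟩
      exact hne rfl

/-- Lengthening a path by one step leaves it admissible, and then it computes the transport, or
makes its composition zero. -/
lemma link_comp_transport {u v w : Multidegree d} (h : Adjacent v w) :
    S.link v w ∘ₗ S.transport u v = 0 ∨ S.link v w ∘ₗ S.transport u v = S.transport u w := by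
  rcases S.transport_eq_pathMap_or u v with ⟨p, hp⟩ | h0
  · rw [hp]
    obtain ⟨q, h | h⟩ := h
    · exact pathMap_eq_transport_or (.up p q h)
    · exact pathMap_eq_transport_or (.down p q h)
  · rw [h0, LinearMap.comp_zero]
    exact Or.inl rfl

/-- Only the last step of the path matters: adding `e_q` gives vanishing on `X_q`, subtracting it
gives vanishing on any other component. The default value 0 vanishes everywhere. -/
lemma transport_mem_vanishing {u w : Multidegree d} (h : u ≠ w) (s : S.H u) :
    ∃ q, S.transport u w s ∈ C.vanishing {q} (S.L w) := by
  rcases S.transport_eq_pathMap_or u w with ⟨p, hp⟩ | h0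
  · rw [hp]
    cases p with
    | nil => exact absurd rfl h
    | up p q h => exact ⟨q, link_mem_vanishing_up h _⟩
    | down p q h =>
      obtain ⟨q', hq'⟩ : ∃ q' : Fin 3, q' ≠ q := exists_ne q
      exact ⟨q', ChainCurve.VanishesOn.mono (Set.singleton_subset_iff.2 hq')
        (link_mem_vanishing_down h (S.pathMap p s))⟩
  · rw [h0]
    exact ⟨0, zero_mem _⟩

/-! ### Sections vanishing on a component -/

/-- The kernel of the linking map that subtracts `e_q` is exactly the sections vanishing on `X_q`;
the hypothesis says that its target is a nonnegative multidegree. -/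
lemma exists_link_eq_zero_down {v : Multidegree d} {q : Fin 3} (hq : ∀ p, 0 ≤ (v.1 p : ℤ) + -twist q p)
    {s : S.H v} (hs : s ∈ C.vanishing {q} (S.L v)) : ∃ w, Adjacent v w ∧ S.link v w s = 0 := by
  obtain ⟨w, hw⟩ := exists_multidegree v _ hq (by rw [Finset.sum_neg_distrib, sum_twist, neg_zero])
  have h : IsTwist q w v := fun p => by rw [hw]; ring
  exact ⟨w, ⟨q, Or.inr h⟩, ((S.down_factors w v q h).1 ⊤ s).2 hs⟩

lemma exists_link_eq_zero_up {v : Multidegree d} {q : Fin 3} (hq : ∀ p, 0 ≤ (v.1 p : ℤ) + twist q p)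
    {s : S.H v} (hs : s ∈ C.vanishing {q}ᶜ (S.L v)) : ∃ w, Adjacent v w ∧ S.link v w s = 0 := by
  obtain ⟨w, h⟩ := exists_multidegree v _ hq (sum_twist q)
  exact ⟨w, ⟨q, Or.inl h⟩, ((S.up_factors v w q h).1 ⊤ s).2 hs⟩

lemma mem_vanishing_of_degree_zero {v : Multidegree d} {p q : Fin 3}
    (hpq : ∃ x, ∃ y, C.ι q x = C.ι p y) (hdeg : v.1 q = 0) {s : S.H v}
    (hs : s ∈ C.vanishing {p} (S.L v)) : s ∈ C.vanishing {q} (S.L v) := by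
  refine ChainCurve.vanishesOn_of_degree_zero hpq ?_ hs
  simpa [hdeg] using S.multidegree v q

variable (C) in
lemma _root_.LimitLinear.ChainCurve.exists_node_symm {p q : Fin 3}
    (h : ∃ x, ∃ y, C.ι q x = C.ι p y) : ∃ x, ∃ y, C.ι p x = C.ι q y := by
  obtain ⟨x, y, h⟩ := h
  exact ⟨y, x, h.symm⟩

/-- A section of `ℒ_v` vanishing on one of the components is zero or is killed by the linking map to
some adjacent multidegree. -/
lemma eq_zero_or_exists_link_eq_zero {v : Multidegree d} {q : Fin 3} {s : S.H v}
    (hs : s ∈ C.vanishing {q} (S.L v)) : s = 0 ∨ ∃ w, Adjacent v w ∧ S.link v w s = 0 := by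
  -- For a section vanishing on two adjacent components, adding the twist of the third kills it.
  -- This is impossible only if the third degree is zero, and then the section vanishes everywhere.
  have h01 : s ∈ C.vanishing {0} (S.L v) → s ∈ C.vanishing {1} (S.L v) →
      s = 0 ∨ ∃ w, Adjacent v w ∧ S.link v w s = 0 := by
    intro h0 h1
    by_cases h : v.1 2 = 0
    · have h2 := mem_vanishing_of_degree_zero C.exists_node_12 h h1
      exact Or.inl (eq_zero_of_mem_vanishing (fun q => by fin_cases q <;> simp)
        (vanishing_union h0 (vanishing_union h1 h2)))
    · refine Or.inr (exists_link_eq_zero_up (q := 2) (fun p => ?_) ?_)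
      · fin_cases p <;> simp [twist] <;> omega
      · have : ({2}ᶜ : Set (Fin 3)) = {0} ∪ {1} := by ext q; fin_cases q <;> simp
        rw [this]
        exact vanishing_union h0 h1
  have h12 : s ∈ C.vanishing {1} (S.L v) → s ∈ C.vanishing {2} (S.L v) →
      s = 0 ∨ ∃ w, Adjacent v w ∧ S.link v w s = 0 := by
    intro h1 h2
    by_cases h : v.1 0 = 0
    · have h0 := mem_vanishing_of_degree_zero (C.exists_node_symm C.exists_node_01) h h1
      exact Or.inl (eq_zero_of_mem_vanishing (fun q => by fin_cases q <;> simp)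
        (vanishing_union h0 (vanishing_union h1 h2)))
    · refine Or.inr (exists_link_eq_zero_up (q := 0) (fun p => ?_) ?_)
      · fin_cases p <;> simp [twist] <;> omega
      · have : ({0}ᶜ : Set (Fin 3)) = {1} ∪ {2} := by ext q; fin_cases q <;> simp
        rw [this]
        exact vanishing_union h1 h2
  -- Subtracting `e_q` lowers the degrees of the neighbours of `X_q`. If one of these is zero, the
  -- section also vanishes on that neighbour, which is the previous case.
  obtain rfl | rfl | rfl : q = 0 ∨ q = 1 ∨ q = 2 := by
    clear * -
    revert q
    decide
  · by_cases h : v.1 1 = 0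
    · exact h01 hs (mem_vanishing_of_degree_zero C.exists_node_01 h hs)
    · refine Or.inr (exists_link_eq_zero_down (q := 0) (fun p => ?_) hs)
      fin_cases p <;> simp [twist] <;> omega
  · by_cases h0 : v.1 0 = 0
    · exact h01 (mem_vanishing_of_degree_zero (C.exists_node_symm C.exists_node_01) h0 hs) hs
    by_cases h2 : v.1 2 = 0
    · exact h12 hs (mem_vanishing_of_degree_zero C.exists_node_12 h2 hs)
    refine Or.inr (exists_link_eq_zero_down (q := 1) (fun p => ?_) hs)
    fin_cases p <;> simp [twist] <;> omega
  · by_cases h : v.1 1 = 0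
    · exact h12 (mem_vanishing_of_degree_zero (C.exists_node_symm C.exists_node_12) h hs) hs
    · refine Or.inr (exists_link_eq_zero_down (q := 2) (fun p => ?_) hs)
      fin_cases p <;> simp [twist] <;> omega

end LinkedSheaves
namespace LimitLinearSeries

/-! ### Simple bases -/

variable {k : Type u} [Field k] {C : ChainCurve k} {d r : ℕ} {g : LimitLinearSeries C d r}

namespace SimpleBasis

variable (b : g.SimpleBasis)

/-- The index set of a simple basis. -/
abbrev Index : Type := Σ α, Fin (b.rk α)

/-- The images in `V_v` of the sections of a simple basis. -/
def image (v : Multidegree d) (p : b.Index) : g.H v :=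
  g.transport (b.deg p.1) v (b.s p.1 p.2)

/-- The indices of the sections of a simple basis in `V_v`. -/
def indicesAt (v : Multidegree d) : Set b.Index := {p | b.deg p.1 = v}

/-- The span of the images in `V_v` of the sections of other multidegrees. -/
def old (v : Multidegree d) : Submodule k (g.H v) :=
  Submodule.span k (b.image v '' (b.indicesAt v)ᶜ)

/-- The span of the sections in `V_v`. -/
def new (v : Multidegree d) : Submodule k (g.H v) :=
  Submodule.span k (b.image v '' b.indicesAt v)

lemma image_mem (v : Multidegree d) (p : b.Index) : b.image v p ∈ g.V v := by
  rw [← b.images_span v]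
  exact Submodule.subset_span ⟨p, rfl⟩

lemma old_sup_new (v : Multidegree d) : b.old v ⊔ b.new v = g.V v := by
  rw [old, new, ← Submodule.span_union, ← Set.image_union, Set.compl_union_self, Set.image_univ]
  exact b.images_span v

lemma disjoint_old_new (v : Multidegree d) : Disjoint (b.old v) (b.new v) :=
  (b.images_linearIndependent v).disjoint_span_image disjoint_compl_left

/-- If a combination of the images is killed by the linking map to an adjacent multidegree, the
coefficients of the sections in `V_v` are zero. -/
lemma coeff_eq_zero {v w : Multidegree d} (h : Adjacent v w) (c : b.Index → k)
    (hc : g.link v w (∑ p, c p • b.image v p) = 0) (p : b.Index) (hp : p ∈ b.indicesAt v) :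
    c p = 0 := by
  -- The linking map is diagonal on the basis images with entries 0 or 1, and the entry is 1 at
  -- sections placed at `v`, where the transport to `v` is the identity.
  have key : ∀ p : b.Index, ∃ ε : k, (p ∈ b.indicesAt v → ε = 1) ∧
      g.link v w (b.image v p) = ε • b.image w p := by
    intro p
    by_cases hp : b.deg p.1 = v
    · refine ⟨1, fun _ => rfl, ?_⟩
      have : ∀ u, u = v → g.link v w ∘ₗ g.transport u v = g.transport u w := by
        rintro u rfl
        rw [g.transport_self, LinkedSheaves.transport_of_adjacent h, LinearMap.comp_id]
      rw [one_smul]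
      exact congr($(this _ hp) (b.s p.1 p.2))
    · rcases LinkedSheaves.link_comp_transport (S := g.toLinkedSheaves) (u := b.deg p.1) h with
        h0 | h1
      · refine ⟨0, fun h => absurd h hp, ?_⟩
        rw [zero_smul]
        exact congr($h0 (b.s p.1 p.2))
      · refine ⟨1, fun _ => rfl, ?_⟩
        rw [one_smul]
        exact congr($h1 (b.s p.1 p.2))
  choose ε hε hlink using key
  rw [map_sum] at hc
  simp only [map_smul, hlink, smul_smul] at hc
  have := Fintype.linearIndependent_iff.1 (b.images_linearIndependent w) _ hc p
  rwa [hε p hp, mul_one] at this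

lemma vanishingOn_le (v : Multidegree d) (q : Fin 3) : g.vanishingOn v q ≤ b.old v := by
  rintro s ⟨hsV, hs⟩
  have hsV' : s ∈ g.V v := hsV
  rw [← b.images_span v, Submodule.mem_span_range_iff_exists_fun] at hsV'
  obtain ⟨c, hc⟩ := hsV'
  rcases LinkedSheaves.eq_zero_or_exists_link_eq_zero (S := g.toLinkedSheaves) hs with
    rfl | ⟨w, hw, h0⟩
  · exact zero_mem _
  · rw [← hc] at h0 ⊢
    refine sum_mem fun p _ => ?_
    by_cases hp : p ∈ b.indicesAt v
    · rw [b.coeff_eq_zero hw c h0 p hp, zero_smul]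
      exact zero_mem _
    · exact Submodule.smul_mem _ _ (Submodule.subset_span ⟨p, hp, rfl⟩)

/-- One inclusion kills the section by a linking map and compares coefficients; the other holds
because a transport between different multidegrees lands in sections vanishing on a component. -/
lemma vanishingSum_eq (v : Multidegree d) : g.vanishingSum v = b.old v := by
  apply le_antisymm
  · exact sup_le (sup_le (b.vanishingOn_le v 0) (b.vanishingOn_le v 1)) (b.vanishingOn_le v 2)
  · rw [old, Submodule.span_le]
    rintro _ ⟨p, hp, rfl⟩
    obtain ⟨q, hq⟩ := LinkedSheaves.transport_mem_vanishing (S := g.toLinkedSheaves)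
      (show b.deg p.1 ≠ v from hp) (b.s p.1 p.2)
    have hmem : b.image v p ∈ g.vanishingOn v q := ⟨b.image_mem v p, hq⟩
    have hle : g.vanishingOn v q ≤ g.vanishingSum v := by
      obtain rfl | rfl | rfl : q = 0 ∨ q = 1 ∨ q = 2 := by
        clear * -
        revert q
        decide
      · exact le_sup_left.trans le_sup_left
      · exact le_sup_right.trans le_sup_left
      · exact le_sup_right
    exact hle hmem

lemma vanishingSum_ne_iff (v : Multidegree d) :
    g.vanishingSum v ≠ g.V v ↔ ∃ α, v = b.deg α := by
  rw [b.vanishingSum_eq]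
  constructor
  · intro hne
    by_contra! h
    apply hne
    have : b.indicesAt v = ∅ := Set.eq_empty_of_forall_notMem fun p hp => h p.1 hp.symm
    rw [← b.old_sup_new, new, this, Set.image_empty, Submodule.span_empty, sup_bot_eq]
  · rintro ⟨α, rfl⟩ heq
    -- Since `rk α` is positive there is a section placed at `deg α`; by independence it is not in
    -- the span of the others.
    have hp : (⟨α, ⟨0, b.rk_pos α⟩⟩ : b.Index) ∉ (b.indicesAt (b.deg α))ᶜ := fun h => h rfl
    refine (b.images_linearIndependent (b.deg α)).notMem_span_image hp ?_
    have := b.image_mem (b.deg α) ⟨α, ⟨0, b.rk_pos α⟩⟩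
    rwa [← heq] at this

lemma new_deg (α : Fin b.m) : b.new (b.deg α) = Submodule.span k (Set.range (b.s α)) := by
  have himage : ∀ j, b.image (b.deg α) ⟨α, j⟩ = b.s α j := fun j => by
    rw [image, g.transport_self]
    rfl
  rw [new]
  congr 1
  ext s
  constructor
  · rintro ⟨⟨β, j⟩, hβ, rfl⟩
    obtain rfl := b.deg_injective hβ
    exact ⟨j, (himage j).symm⟩
  · rintro ⟨j, rfl⟩
    exact ⟨⟨α, j⟩, rfl, himage j⟩

/-! ### Dimension count -/

lemma finrank_quotient (v : Multidegree d) :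
    Module.finrank k (g.V v ⧸ (g.vanishingSum v).submoduleOf (g.V v)) =
      (Finset.univ.filter fun p : b.Index => b.deg p.1 = v).card := by
  rw [b.vanishingSum_eq]
  have hnew : b.new v ≤ g.V v := b.old_sup_new v ▸ le_sup_right
  have hold : b.old v ≤ g.V v := b.old_sup_new v ▸ le_sup_left
  have hc : IsCompl ((b.old v).submoduleOf (g.V v)) ((b.new v).submoduleOf (g.V v)) := by
    constructor
    · rw [Submodule.disjoint_def]
      intro x hx hx'
      exact Subtype.ext (Submodule.disjoint_def.1 (b.disjoint_old_new v) _ hx hx')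
    · rw [codisjoint_iff, eq_top_iff]
      rintro ⟨x, hx⟩ -
      have hx' := hx
      rw [← b.old_sup_new v, Submodule.mem_sup] at hx'
      obtain ⟨y, hy, z, hz, rfl⟩ := hx'
      exact Submodule.mem_sup.2 ⟨⟨y, hold hy⟩, hy, ⟨z, hnew hz⟩, hz, rfl⟩
  rw [(Submodule.quotientEquivOfIsCompl _ _ hc).finrank_eq,
    (Submodule.submoduleOfEquivOfLe hnew).finrank_eq, new, Set.image_eq_range]
  let (p : b.Index) : Decidable (p ∈ b.indicesAt v) :=
    inferInstanceAs (Decidable (b.deg p.1 = v))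
  refine (finrank_span_eq_card ((b.images_linearIndependent v).comp _ Subtype.val_injective)).trans ?_
  exact Fintype.card_subtype _

lemma card_index : Fintype.card b.Index = r + 1 := by
  -- Any multidegree serves; this one exists for every `d`.
  let v : Multidegree d := ⟨![d, 0, 0], by simp [Fin.sum_univ_three]⟩
  rw [← g.finrank_V v, ← b.images_span v, finrank_span_eq_card (b.images_linearIndependent v)]

lemma sum_finrank_quotient (b : g.SimpleBasis) : ∑ v : Multidegree d,
    Module.finrank k (g.V v ⧸ (g.vanishingSum v).submoduleOf (g.V v)) = r + 1 := by
  rw [Finset.sum_congr rfl fun v _ => b.finrank_quotient v, ← b.card_index,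
    ← Finset.card_univ]
  exact (Finset.card_eq_sum_card_fiberwise fun p _ => Finset.mem_univ (b.deg p.1)).symm

end SimpleBasis
end LimitLinearSeries
end LimitLinear

end

theorem mainTheorem6 {k : Type u} [Field k] [IsAlgClosed k] (C : LimitLinear.ChainCurve k)
    (d r : ℕ) (g : LimitLinear.LimitLinearSeries C d r) (hg : g.IsSimple) :
    (∑ v : LimitLinear.Multidegree d,
      Module.finrank k (g.V v ⧸ (g.vanishingSum v).submoduleOf (g.V v)) = r + 1) ∧
    ∀ b : g.SimpleBasis,
      (∀ v, g.vanishingSum v ≠ g.V v ↔ ∃ α, v = b.deg α) ∧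
      ∀ α, g.vanishingSum (b.deg α) ⊔ Submodule.span k (Set.range (b.s α)) = g.V (b.deg α) ∧
        Disjoint (g.vanishingSum (b.deg α)) (Submodule.span k (Set.range (b.s α))) := by
  refine ⟨hg.elim fun b => b.sum_finrank_quotient, fun b => ⟨b.vanishingSum_ne_iff, fun α => ?_⟩⟩
  rw [b.vanishingSum_eq, ← b.new_deg]
  exact ⟨b.old_sup_new _, b.disjoint_old_new _⟩
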